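/- **Proposition 6.17.** Let $M$ be a smooth manifold (finite-dimensional, Hausdorff, second countable, without boundary), $A=C^\infty(M)$ its $\mathbb R$-algebra of smooth real functions, $\Omega^1$ and $\Omega^2$ the $A$-modules of smooth one- and two-forms, $d:A\to\Omega^1$ the de Rham differential and $\wedge:\Omega^1\otimes_A\Omega^1\to\Omega^2$ the wedge product. Consider the following notions attached to this calculus. * Let $J^1A=A\oplus\Omega^1$ as an $A$-module, with prolongation $j^1(f)=(f,df)$ and inclusion $\iota:\Omega^1\to J^1A$, $\iota(\alpha)=(0,\alpha)$. An $\mathbb R$-linear map $\Delta:A\to A$ is a differential operator of order at most one if $\Delta=\widetilde\Delta\circ j^1$ for some (necessarily unique) $A$-linear $\widetilde\Delta:J^1A\to A$. Let $\mathfrak X_d$ be the $A$-module of those differential operators of order at most one that vanish on $\ker d$. * For $X\in\mathfrak X_d$ and $\alpha\in\Omega^1$ put $\langle\alpha,X\rangle=\widetilde X(\iota(\alpha))$. Pair $\Omega^1\otimes_A\Omega^1$ with $\mathfrak X_d\otimes_A\mathfrak X_d$ by $\langle\!\langle\alpha\otimes\beta,X\otimes Y\rangle\!\rangle=\langle\alpha\langle\beta,X\rangle,Y\rangle$.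 Let $S^2=\ker(\wedge)\subseteq\Omega^1\otimes_A\Omega^1$, let $\mathrm{Ann}(S^2)\subseteq\mathfrak X_d\otimes_A\mathfrak X_d$ be the set of elements that pair to zero with all of $S^2$, and let $\mathrm{Asym}(\mathfrak X_d)$ be the preimage of $\mathrm{Ann}(S^2)$ under the projection $\mathfrak X_d\otimes_{\mathbb R}\mathfrak X_d\to\mathfrak X_d\otimes_A\mathfrak X_d$. * Let $c$ be the linear map on $\mathfrak X_d\otimes_{\mathbb R}\mathfrak X_d$ with $c(X\otimes Y)=Y\circ X$. The quantum Lie bracket induced by a linear map $\wp:\mathfrak X_d\otimes_{\mathbb R}\mathfrak X_d\to\mathrm{Asym}(\mathfrak X_d)$ is $[X,Y]^{\wp}=c(\wp(Y\otimes X))$. Then $\wp(X\otimes Y)=X\otimes Y-Y\otimes X$ defines an $\mathbb R$-linear map $\mathfrak X_d\otimes_{\mathbb R}\mathfrak X_d\to\mathrm{Asym}(\mathfrak X_d)$; the bracket $[X,Y]^{\wp}$ lies in $\mathfrak X_d$ for all $X,Y\in\mathfrak X_d$; and the rule $\Phi(V)(f)=df(V)$ defines an isomorphism of $A$-modules $\Phi$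 from the smooth vector fields on $M$ onto $\mathfrak X_d$ with $$[\Phi(V),\Phi(W)]^{\wp}=\Phi([V,W])$$ for all smooth vector fields $V,W$, where $[V,W]$ is the classical Lie bracket. That is, the quantum Lie bracket is the classical Lie bracket of vector fields. -/

import Mathlib

open scoped TensorProduct Manifold ContDiff Bundle

noncomputable section

namespace QuantumBracket

/-! ### Differential operators, vector fields and the quantum Lie bracket -/

section Algebra

/-- The map `X ⊗ Y ↦ X ⊗ Y - Y ⊗ X` on the tensor square of a module. -/
def antisymmetrizer (k V : Type*) [CommRing k] [AddCommGroup V] [Module k V] :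
    V ⊗[k] V →ₗ[k] V ⊗[k] V :=
  LinearMap.id - (TensorProduct.comm k V V).toLinearMap

theorem antisymmetrizer_tmul {k V : Type*} [CommRing k] [AddCommGroup V] [Module k V] (X Y : V) :
    antisymmetrizer k V (X ⊗ₜ[k] Y) = X ⊗ₜ[k] Y - Y ⊗ₜ[k] X := rfl

/-- The part of an exterior algebra `Ω` over a commutative `k`-algebra `A = Ω⁰` on which vector fields
and their bracket depend: the modules `Ω₁`, `Ω₂` of forms of degree one and two (bimodules on which
the left and the right action of `A` agree), the differential `d : A → Ω₁` and the product
`Ω₁ × Ω₁ → Ω₂`.  Of the requirement that the forms are generated by `A` and `d A` only the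
consequence that matters for differential operators is recorded, namely that `A`-linear maps out of
`Ω₁` are determined by their values on exact forms. -/
structure ExteriorCalculus (k : Type*) (A : Type*) (Ω₁ : Type*) (Ω₂ : Type*)
    [CommRing k] [CommRing A] [Algebra k A]
    [AddCommGroup Ω₁] [Module k Ω₁] [Module A Ω₁] [IsScalarTower k A Ω₁]
    [AddCommGroup Ω₂] [Module A Ω₂] where
  /-- the differential in degree zero -/
  d : Derivation k A Ω₁
  /-- the product of one-forms -/
  wedge : Ω₁ →ₗ[A] Ω₁ →ₗ[A] Ω₂
  /-- an `A`-linear map on one-forms is determined by its values on exact forms -/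
  eq_zero_of_comp_d : ∀ θ : Ω₁ →ₗ[A] A, (∀ a, θ (d a) = 0) → θ = 0

variable {k A Ω₁ Ω₂ : Type*} [CommRing k] [CommRing A] [Algebra k A]
  [AddCommGroup Ω₁] [Module k Ω₁] [Module A Ω₁] [IsScalarTower k A Ω₁]
  [AddCommGroup Ω₂] [Module A Ω₂]

namespace ExteriorCalculus

variable (C : ExteriorCalculus k A Ω₁ Ω₂)

/-- The one-jet prolongation `j¹ : A → J¹ A`, `a ↦ (a, d a)`.  Here the left `A`-module `J¹ A` is
written as `A × Ω₁`, via the left `A`-linear isomorphism that sends the jet `c • j¹ a` to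
`(c a, c d a)`; the inclusion `ι : Ω₁ → J¹ A` is then `α ↦ (0, α)`. -/
def jetProlongation : A →ₗ[k] A × Ω₁ :=
  LinearMap.prod LinearMap.id (C.d : A →ₗ[k] Ω₁)

/-- `Diff¹(A, A)`: the `k`-linear maps `A → A` that factor as `L ∘ j¹` with `L : J¹ A → A` linear
over `A`.  The `A`-module structure is `(c • Δ) a = c * Δ a`. -/
def diffOne : Submodule A (A →ₗ[k] A) where
  carrier := {Δ | ∃ L : (A × Ω₁) →ₗ[A] A, ∀ a, L (C.jetProlongation a) = Δ a}
  add_mem' := by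
    rintro Δ Δ' ⟨L, hL⟩ ⟨L', hL'⟩
    exact ⟨L + L', fun a => by simp [hL, hL']⟩
  zero_mem' := ⟨0, fun a => by simp⟩
  smul_mem' := by
    rintro c Δ ⟨L, hL⟩
    exact ⟨c • L, fun a => by simp [hL]⟩

/-- The module `𝔛` of vector fields of the calculus: the differential operators `A → A` of order at
most one that annihilate `ker d`. -/
def vectorFields : Submodule A (A →ₗ[k] A) where
  carrier := {X | X ∈ C.diffOne ∧ ∀ a, C.d a = 0 → X a = 0}
  add_mem' := by
    rintro X Y ⟨hX, hX'⟩ ⟨hY, hY'⟩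
    exact ⟨add_mem hX hY, fun a ha => by simp [hX' a ha, hY' a ha]⟩
  zero_mem' := ⟨zero_mem _, fun a _ => rfl⟩
  smul_mem' := by
    rintro c X ⟨hX, hX'⟩
    exact ⟨Submodule.smul_mem _ c hX, fun a ha => by simp [hX' a ha]⟩

/-- Two `A`-linear maps on `J¹ A` agree if they agree on prolongations. -/
theorem lift_unique {L L' : (A × Ω₁) →ₗ[A] A}
    (h : ∀ a, L (C.jetProlongation a) = L' (C.jetProlongation a)) : L = L' := by
  have h1 : ∀ c : A, L (c, 0) = L' (c, 0) := by
    intro c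
    have h0 := h 1
    simp only [jetProlongation, LinearMap.prod_apply, Function.prod, LinearMap.id_apply,
      Derivation.coeFn_coe, Derivation.map_one_eq_zero] at h0
    have : ((c, 0) : A × Ω₁) = c • ((1, 0) : A × Ω₁) := by simp
    rw [this, map_smul, map_smul, h0]
  have h2 : (L - L') ∘ₗ LinearMap.inr A A Ω₁ = 0 := by
    apply C.eq_zero_of_comp_d
    intro a
    have ha := h a
    have e : C.jetProlongation a = (a, 0) + (0, C.d a) := by
      simp [jetProlongation]
    rw [e, map_add, map_add, h1] at ha
    simpa [sub_eq_zero] using ha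
  ext x
  · simpa using h1 1
  · simpa [sub_eq_zero] using congrArg (fun f => f x) h2

/-- The lift to `J¹ A` of an operator of order at most one (unique by `lift_unique`). -/
def lift (X : C.diffOne) : (A × Ω₁) →ₗ[A] A := Classical.choose X.2

theorem lift_jetProlongation (X : C.diffOne) (a : A) :
    C.lift X (C.jetProlongation a) = (X : A →ₗ[k] A) a := Classical.choose_spec X.2 a

/-- The interior product `⟨α, X⟩ = L (ι α)`, where `L` is the lift of `X` to `J¹ A`; written
`C.interior X α`. -/
def interior : C.vectorFields →ₗ[A] Ω₁ →ₗ[A] A where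
  toFun X := C.lift ⟨X, X.2.1⟩ ∘ₗ LinearMap.inr A A Ω₁
  map_add' X Y := by
    rw [← LinearMap.add_comp]
    congr 1
    apply C.lift_unique
    intro a
    simp [lift_jetProlongation]
  map_smul' c X := by
    rw [RingHom.id_apply, ← LinearMap.smul_comp]
    congr 1
    apply C.lift_unique
    intro a
    simp [lift_jetProlongation]

/-- The pairing `⟪α ⊗ β, X ⊗ Y⟫ = ⟨α ⟨β, X⟩, Y⟩` of `Ω₁ ⊗[A] Ω₁` with `𝔛 ⊗[A] 𝔛`; written
`C.pairing (X ⊗ Y) (α ⊗ β)`. -/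
def pairing : (C.vectorFields ⊗[A] C.vectorFields) →ₗ[A] (Ω₁ ⊗[A] Ω₁) →ₗ[A] A :=
  TensorProduct.lift <| LinearMap.mk₂ A
    (fun X Y => TensorProduct.lift <| LinearMap.mk₂ A
      (fun α β => C.interior Y (C.interior X β • α))
      (fun α α' β => by simp [smul_add])
      (fun c α β => by simp; ring)
      (fun α β β' => by simp [add_smul])
      (fun c α β => by simp [mul_assoc]))
    (fun X X' Y => by ext α β; simp [add_mul])
    (fun c X Y => by ext α β; simp [mul_assoc])
    (fun X Y Y' => by ext α β; simp [mul_add])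
    (fun c X Y => by ext α β; simp; ring)

theorem pairing_tmul (X Y : C.vectorFields) (α β : Ω₁) :
    C.pairing (X ⊗ₜ[A] Y) (α ⊗ₜ[A] β) = C.interior Y (C.interior X β • α) := rfl

/-- The quantum symmetric forms `S²` of degree two: the kernel of `∧ : Ω₁ ⊗[A] Ω₁ → Ω₂`. -/
def symTwo : Submodule A (Ω₁ ⊗[A] Ω₁) := LinearMap.ker (TensorProduct.lift C.wedge)

/-- `Ann(S²)`: the elements of `𝔛 ⊗[A] 𝔛` that pair to zero with all of `S²`. -/
def annSymTwo : Submodule A (C.vectorFields ⊗[A] C.vectorFields) where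
  carrier := {t | ∀ σ ∈ C.symTwo, C.pairing t σ = 0}
  add_mem' := fun hs ht σ hσ => by simp [hs σ hσ, ht σ hσ]
  zero_mem' := fun σ _ => by simp
  smul_mem' := fun c t ht σ hσ => by simp [ht σ hσ]

/-- The canonical projection `𝔛 ⊗[k] 𝔛 → 𝔛 ⊗[A] 𝔛`. -/
def tensorProj :
    (C.vectorFields ⊗[k] C.vectorFields) →ₗ[k] (C.vectorFields ⊗[A] C.vectorFields) :=
  TensorProduct.lift <| LinearMap.mk₂ k (fun X Y => X ⊗ₜ[A] Y)
    (fun X X' Y => TensorProduct.add_tmul X X' Y)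
    (fun _ _ _ => rfl)
    (fun X Y Y' => TensorProduct.tmul_add X Y Y')
    (fun _ _ _ => by simp)

/-- `Asym(𝔛)`: the preimage of `Ann(S²)` in `𝔛 ⊗[k] 𝔛`. -/
def asym : Submodule k (C.vectorFields ⊗[k] C.vectorFields) :=
  (C.annSymTwo.restrictScalars k).comap C.tensorProj

/-- The composition map `X ⊗ Y ↦ Y ∘ X`, with values in the `k`-linear operators on `A`. -/
def comp : (C.vectorFields ⊗[k] C.vectorFields) →ₗ[k] (A →ₗ[k] A) :=
  TensorProduct.lift <| LinearMap.mk₂ k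
    (fun X Y => (Y : A →ₗ[k] A) ∘ₗ (X : A →ₗ[k] A))
    (fun X X' Y => by ext a; simp)
    (fun c X Y => by ext a; simp)
    (fun X Y Y' => by ext a; simp)
    (fun c X Y => by ext a; simp)

/-- `p : 𝔛 ⊗[k] 𝔛 → Asym(𝔛)` is the canonical antisymmetrization `X ⊗ Y ↦ X ⊗ Y - Y ⊗ X`. -/
def IsAntisymmetrization (p : (C.vectorFields ⊗[k] C.vectorFields) →ₗ[k] C.asym) : Prop :=
  ∀ t : C.vectorFields ⊗[k] C.vectorFields,
    (p t : C.vectorFields ⊗[k] C.vectorFields) = antisymmetrizer k C.vectorFields t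

/-- The quantum Lie bracket `[X, Y] = comp (p (Y ⊗ X))` induced by a `k`-linear map
`p : 𝔛 ⊗[k] 𝔛 → Asym(𝔛)`, as an operator on `A`. -/
def bracket (p : (C.vectorFields ⊗[k] C.vectorFields) →ₗ[k] C.asym)
    (X Y : C.vectorFields) : A →ₗ[k] A :=
  C.comp (p (Y ⊗ₜ[k] X))

end ExteriorCalculus

end Algebra

/-! ### Smooth sections, differential forms and the de Rham calculus of a manifold -/

section Sections

variable {E : Type*} [NormedAddCommGroup E] [NormedSpace ℝ E]
  {H : Type*} [TopologicalSpace H] {I : ModelWithCorners ℝ E H}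
  {M : Type*} [TopologicalSpace M] [ChartedSpace H M]
  {F : Type*} [NormedAddCommGroup F] [NormedSpace ℝ F]
  {V : M → Type*} [TopologicalSpace (Bundle.TotalSpace F V)]
  [∀ x, AddCommGroup (V x)] [∀ x, Module ℝ (V x)] [∀ x, TopologicalSpace (V x)]
  [FiberBundle F V] [VectorBundle ℝ F V]

/-- Smooth functions act pointwise on smooth sections of a vector bundle. -/
instance sectionSMul : SMul C^∞⟮I, M; ℝ⟯ Cₛ^∞⟮I; F, V⟯ :=
  ⟨fun f s => ⟨fun x => f x • s x, f.contMDiff.smul_section s.contMDiff⟩⟩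

theorem section_smul_apply (f : C^∞⟮I, M; ℝ⟯) (s : Cₛ^∞⟮I; F, V⟯) (x : M) :
    (f • s) x = f x • s x := rfl

instance sectionModule : Module C^∞⟮I, M; ℝ⟯ Cₛ^∞⟮I; F, V⟯ where
  one_smul s := by ext x; exact one_smul ℝ (s x)
  mul_smul f g s := by ext x; exact mul_smul (f x) (g x) (s x)
  smul_zero f := by ext x; exact smul_zero (f x)
  smul_add f s t := by ext x; exact smul_add (f x) (s x) (t x)
  add_smul f g s := by ext x; exact add_smul (f x) (g x) (s x)
  zero_smul s := by ext x; exact zero_smul ℝ (s x)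

instance sectionTower : IsScalarTower ℝ C^∞⟮I, M; ℝ⟯ Cₛ^∞⟮I; F, V⟯ :=
  ⟨fun c f s => by ext x; exact smul_assoc c (f x) (s x)⟩

end Sections

section DeRham

variable {E : Type*} [NormedAddCommGroup E] [NormedSpace ℝ E]
  {H : Type*} [TopologicalSpace H] (I : ModelWithCorners ℝ E H)
  (M : Type*) [TopologicalSpace M] [ChartedSpace H M] [IsManifold I ∞ M]

/-- Smooth vector fields on `M`: smooth sections of the tangent bundle. -/
abbrev SmoothVectorField : Type _ := Cₛ^∞⟮I; E, (TangentSpace I : M → Type _)⟯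

/-- Smooth one-forms on `M`: smooth sections of the cotangent bundle. -/
abbrev OneForm : Type _ :=
  Cₛ^∞⟮I; E →L[ℝ] ℝ, fun x : M => TangentSpace I x →L[ℝ] Bundle.Trivial M ℝ x⟯

/-- Smooth two-forms on `M`: smooth sections of the bundle of alternating bilinear forms on the
tangent spaces. -/
abbrev TwoForm : Type _ :=
  Cₛ^∞⟮I; E [⋀^Fin 2]→L[ℝ] ℝ,
    fun x : M => TangentSpace I x [⋀^Fin 2]→L[ℝ] Bundle.Trivial M ℝ x⟯

variable {I M}

theorem contMDiff_mvfderiv (f : C^∞⟮I, M; ℝ⟯) :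
    ContMDiff I (I.prod 𝓘(ℝ, E →L[ℝ] ℝ)) ∞
      (fun x => Bundle.TotalSpace.mk' (E →L[ℝ] ℝ)
        (E := fun x : M => TangentSpace I x →L[ℝ] Bundle.Trivial M ℝ x) x (mvfderiv I f x)) := by
  intro x
  rw [contMDiffAt_hom_bundle]
  refine ⟨contMDiffAt_id, ?_⟩
  have h := (f.contMDiff x).mfderiv_const (m := ∞) (by simp)
  refine h.congr_of_eventuallyEq (Filter.Eventually.of_forall fun y => ?_)
  ext v
  simp [inTangentCoordinates, ContinuousLinearMap.inCoordinates, mvfderiv]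
  rfl

/-- The de Rham differential `f ↦ df` on smooth functions. -/
def differential : Derivation ℝ C^∞⟮I, M; ℝ⟯ (OneForm I M) where
  toFun f := ⟨fun x => mvfderiv I f x, contMDiff_mvfderiv f⟩
  map_add' f g := by
    ext x : 1
    exact mvfderiv_add f.mdifferentiableAt g.mdifferentiableAt
  map_smul' c f := by
    ext x : 1
    have := mvfderiv_smul (mdifferentiableAt_const (c := c)) (f.mdifferentiableAt (x := x))
    rw [mvfderiv_const] at this
    exact this.trans (by ext v; simp)
  map_one_eq_zero' := by
    ext x : 1
    exact mvfderiv_const 1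
  leibniz' f g := by
    ext x : 1
    have := mvfderiv_mul f.mdifferentiableAt (g.mdifferentiableAt (x := x))
    exact this

/-- The wedge product of two covectors, `(α ∧ β)(v₀, v₁) = α v₀ β v₁ - α v₁ β v₀`. -/
def wedgeAt {T : Type*} [AddCommGroup T] [Module ℝ T] [TopologicalSpace T]
    (α β : T →L[ℝ] ℝ) : T [⋀^Fin 2]→L[ℝ] ℝ :=
  ContinuousMultilinearMap.alternatization
    ((ContinuousMultilinearMap.mkPiAlgebra ℝ (Fin 2) ℝ).compContinuousLinearMap ![α, β])

theorem wedgeAt_apply {T : Type*} [AddCommGroup T] [Module ℝ T] [TopologicalSpace T]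
    (α β : T →L[ℝ] ℝ) (v : Fin 2 → T) :
    wedgeAt α β v = α (v 0) * β (v 1) - α (v 1) * β (v 0) := by
  have h := Matrix.det_fin_two (Matrix.of fun i j : Fin 2 => (![α, β] : Fin 2 → T →L[ℝ] ℝ) j (v i))
  rw [Matrix.det_apply] at h
  simp only [wedgeAt, ContinuousMultilinearMap.alternatization_apply_apply]
  simpa [Fin.prod_univ_two, mul_comm] using h

theorem isBoundedBilinearMap_wedgeAt :
    IsBoundedBilinearMap ℝ (fun p : (E →L[ℝ] ℝ) × (E →L[ℝ] ℝ) => wedgeAt p.1 p.2) where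
  add_left a a' b := by ext v; simp [wedgeAt_apply]; ring
  smul_left c a b := by ext v; simp [wedgeAt_apply]; ring
  add_right a b b' := by ext v; simp [wedgeAt_apply]; ring
  smul_right c a b := by ext v; simp [wedgeAt_apply]; ring
  bound := by
    refine ⟨2, by norm_num, fun a b => ?_⟩
    refine ContinuousAlternatingMap.opNorm_le_bound _ (by positivity) fun v => ?_
    have h (i j : Fin 2) : |a (v i) * b (v j)| ≤ ‖a‖ * ‖b‖ * (‖v i‖ * ‖v j‖) := by
      rw [abs_mul]
      calc |a (v i)| * |b (v j)| ≤ (‖a‖ * ‖v i‖) * (‖b‖ * ‖v j‖) :=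
            mul_le_mul (a.le_opNorm _) (b.le_opNorm _) (abs_nonneg _) (by positivity)
        _ = _ := by ring
    rw [wedgeAt_apply, Fin.prod_univ_two, Real.norm_eq_abs]
    calc _ ≤ |a (v 0) * b (v 1)| + |a (v 1) * b (v 0)| := abs_sub _ _
      _ ≤ _ := by linarith [h 0 1, h 1 0, mul_comm ‖v 0‖ ‖v 1‖]

theorem contMDiff_wedgeAt (α β : OneForm I M) :
    ContMDiff I (I.prod 𝓘(ℝ, E [⋀^Fin 2]→L[ℝ] ℝ)) ∞
      (fun x => Bundle.TotalSpace.mk' (E [⋀^Fin 2]→L[ℝ] ℝ)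
        (E := fun x : M => TangentSpace I x [⋀^Fin 2]→L[ℝ] Bundle.Trivial M ℝ x) x
        (wedgeAt (α x) (β x))) := by
  intro x
  have hα := ((contMDiffAt_hom_bundle _).1 (α.contMDiff x)).2
  have hβ := ((contMDiffAt_hom_bundle _).1 (β.contMDiff x)).2
  rw [Bundle.contMDiffAt_section]
  have hW := (isBoundedBilinearMap_wedgeAt (E := E)).contDiff.contMDiff.contMDiffAt.comp x (hα.prodMk_space hβ)
  refine hW.congr_of_eventuallyEq (Filter.Eventually.of_forall fun y => ?_)
  ext v
  simp [wedgeAt_apply, FiberBundle.trivializationAt_continuousAlternatingMap_apply, ContinuousAlternatingMap.inCoordinates, ContinuousLinearMap.inCoordinates]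

/-- The wedge product of smooth one-forms. -/
def wedge :
    OneForm I M →ₗ[C^∞⟮I, M; ℝ⟯] OneForm I M →ₗ[C^∞⟮I, M; ℝ⟯] TwoForm I M :=
  LinearMap.mk₂ _ (fun α β => ⟨fun x => wedgeAt (α x) (β x), contMDiff_wedgeAt α β⟩)
    (fun α α' β => by
      ext x v
      exact (by simp [wedgeAt_apply]; ring :
        wedgeAt (α x + α' x) (β x) v = (wedgeAt (α x) (β x) + wedgeAt (α' x) (β x)) v))
    (fun c α β => by
      ext x v
      exact (by simp [wedgeAt_apply]; ring :
        wedgeAt (c x • α x) (β x) v = (c x • wedgeAt (α x) (β x)) v))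
    (fun α α' β => by
      ext x v
      exact (by simp [wedgeAt_apply]; ring :
        wedgeAt (α x) (α' x + β x) v = (wedgeAt (α x) (α' x) + wedgeAt (α x) (β x)) v))
    (fun c α β => by
      ext x v
      exact (by simp [wedgeAt_apply]; ring :
        wedgeAt (α x) (c x • β x) v = (c x • wedgeAt (α x) (β x)) v))

theorem exists_bump [FiniteDimensional ℝ E] [T2Space M] (x : M) :
    ∀ U ∈ nhds x, ∃ χ : C^∞⟮I, M; ℝ⟯, χ x = 1 ∧ Function.support χ ⊆ U := by
  intro U hU
  obtain ⟨χ, -, hχ⟩ := (SmoothBumpFunction.nhds_basis_support (I := I) hU).mem_iff.1 hU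
  exact ⟨⟨χ, χ.contMDiff⟩, χ.eq_one, hχ⟩

/-- Near every point, a one-form is `∑ cᵢ dgᵢ` with global smooth `cᵢ`, `gᵢ`. -/
theorem exists_local_expansion [FiniteDimensional ℝ E] [T2Space M] (η : OneForm I M) (x : M) :
    ∃ (ι : Type) (_ : Fintype ι) (c g : ι → C^∞⟮I, M; ℝ⟯), ∀ᶠ y in nhds x,
      η y = (∑ i, c i • differential (g i) : OneForm I M) y := by
  let b := Module.finBasis ℝ E
  let e := trivializationAt E (TangentSpace I : M → Type _) x
  obtain ⟨χ, -, -⟩ := (SmoothBumpFunction.nhds_basis_support (I := I)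
    (Filter.univ_mem : Set.univ ∈ nhds x)).mem_iff.1 Filter.univ_mem
  have hsrc : e.baseSet = (chartAt H x).source := by simp [e]
  have hg : ∀ i, ContMDiffOn I 𝓘(ℝ, ℝ) ∞ (fun y => b.coord i (extChartAt I x y)) (chartAt H x).source := by
    intro i
    exact (LinearMap.toContinuousLinearMap (b.coord i)).contMDiff.comp_contMDiffOn contMDiffOn_extChartAt
  have hc : ∀ i, ContMDiffOn I 𝓘(ℝ, ℝ) ∞ (fun y => η y (e.localFrame b i y)) (chartAt H x).source := by
    intro i
    have h1 := e.contMDiffOn_localFrame_baseSet (I := I) ∞ b i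
    rw [hsrc] at h1
    have h2 := η.contMDiff.contMDiffOn.clm_bundle_apply h1
    intro y hy
    exact (Bundle.contMDiffWithinAt_section.1 (h2 y hy))
  let c : Fin (Module.finrank ℝ E) → C^∞⟮I, M; ℝ⟯ := fun i => ⟨_, χ.contMDiff_smul (hc i)⟩
  let g : Fin (Module.finrank ℝ E) → C^∞⟮I, M; ℝ⟯ := fun i => ⟨_, χ.contMDiff_smul (hg i)⟩
  refine ⟨Fin (Module.finrank ℝ E), inferInstance, c, g, ?_⟩
  filter_upwards [χ.eventuallyEq_one.eventuallyEq_nhds, (chartAt H x).open_source.mem_nhds (mem_chart_source H x)] with y hy hys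
  have hye : y ∈ e.baseSet := hsrc ▸ hys
  have hd : ∀ i, mvfderiv I (fun z => χ z • b.coord i (extChartAt I x z)) y
      = (LinearMap.toContinuousLinearMap (b.coord i)) ∘L e.continuousLinearMapAt ℝ y := by
    intro i
    have h1 : (fun z => χ z • b.coord i (extChartAt I x z)) =ᶠ[nhds y]
        (LinearMap.toContinuousLinearMap (b.coord i)) ∘ (extChartAt I x) := by
      filter_upwards [hy] with z hz
      simp [hz]
    rw [TangentBundle.continuousLinearMapAt_trivializationAt hys]
    ext v
    have h2 := (LinearMap.toContinuousLinearMap (b.coord i)).hasMFDerivAt.comp y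
      (mdifferentiableAt_extChartAt (I := I) hys).hasMFDerivAt
    have h3 := (h2.congr_of_eventuallyEq h1).mfderiv
    simp only [mvfderiv]
    rw [h3]
    rfl
  have hsum : (∑ i, c i • differential (g i) : OneForm I M) y
      = ∑ i, (χ y • η y (e.localFrame b i y)) •
          mvfderiv I (fun z => χ z • b.coord i (extChartAt I x z)) y := by
    have := map_sum (ContMDiffSection.coeAddHom I (E →L[ℝ] ℝ) ∞
      (fun x : M => TangentSpace I x →L[ℝ] Bundle.Trivial M ℝ x))
      (fun i => c i • differential (g i)) Finset.univ
    have h2 := congrFun this y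
    rw [Finset.sum_apply] at h2
    exact h2
  rw [hsum]
  ext v
  have hrepr := (e.basisAt b hye).sum_repr v
  have hη : η y v = ∑ i, (e.basisAt b hye).repr v i • η y (e.basisAt b hye i) := by
    conv_lhs => rw [← hrepr]
    rw [map_sum]
    exact Finset.sum_congr rfl fun i _ => (η y).map_smul _ _
  rw [hη]
  have happ : (∑ i, (χ y • η y (e.localFrame b i y)) •
      mvfderiv I (fun z => χ z • b.coord i (extChartAt I x z)) y) v
      = ∑ i, ((χ y • η y (e.localFrame b i y)) •
      mvfderiv I (fun z => χ z • b.coord i (extChartAt I x z)) y) v :=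
    sum_apply _ _ _
  refine Eq.trans ?_ happ.symm
  refine Finset.sum_congr rfl fun i _ => ?_
  rw [hd i, hy.self_of_nhds, e.localFrame_apply_of_mem_baseSet b hye]
  have hr : (e.basisAt b hye).repr v i = b.repr (e.continuousLinearMapAt ℝ y v) i := by
    simp [Bundle.Trivialization.basisAt, hye]
  rw [hr]
  have hfin : ∀ r : ℝ, b.repr (e.continuousLinearMapAt ℝ y v) i • r
      = (((1 : ℝ) • r) • ((LinearMap.toContinuousLinearMap (b.coord i)) ∘L
        e.continuousLinearMapAt ℝ y)) v := by
    intro r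
    simp [mul_comm]
  exact hfin _

theorem eq_zero_of_comp_differential [FiniteDimensional ℝ E] [T2Space M]
    (θ : OneForm I M →ₗ[C^∞⟮I, M; ℝ⟯] C^∞⟮I, M; ℝ⟯) (h : ∀ f, θ (differential f) = 0) : θ = 0 := by
  ext η x
  obtain ⟨ι, _, c, g, hcg⟩ := exists_local_expansion η x
  obtain ⟨χ, hχ, hs⟩ := exists_bump (I := I) x _ hcg
  have h0 : χ • (η - ∑ i, c i • differential (g i)) = 0 := by
    ext y : 1
    by_cases hy : y ∈ Function.support χ
    · have : (η - ∑ i, c i • differential (g i)) y = 0 := sub_eq_zero.2 (hs hy)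
      rw [section_smul_apply, this, smul_zero]; rfl
    · rw [section_smul_apply, Function.notMem_support.1 hy, zero_smul]; rfl
  have h1 := congrArg θ h0
  simp only [map_smul, map_sub, map_sum, h, smul_zero, Finset.sum_const_zero, sub_zero, map_zero] at h1
  have h2 := DFunLike.congr_fun h1 x
  have h3 : χ x * (θ η) x = 0 := h2
  rw [hχ, one_mul] at h3
  exact h3

variable (I M) in
/-- The de Rham calculus on the algebra `C^∞(M)` of smooth functions of a manifold. -/
def deRham [FiniteDimensional ℝ E] [T2Space M] :
    ExteriorCalculus ℝ C^∞⟮I, M; ℝ⟯ (OneForm I M) (TwoForm I M) where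
  d := differential
  wedge := wedge
  eq_zero_of_comp_d := eq_zero_of_comp_differential

/-- The classical Lie bracket of smooth vector fields. -/
def lieBracket [FiniteDimensional ℝ E] (V W : SmoothVectorField I M) : SmoothVectorField I M where
  toFun := VectorField.mlieBracket I V W
  contMDiff_toFun := fun x => by
    have : CompleteSpace E := FiniteDimensional.complete ℝ E
    have : IsManifold I ((⊤ : ℕ∞) + 1) M := inferInstanceAs (IsManifold I ∞ M)
    have : IsManifold I (minSmoothness ℝ 2) M := by
      rw [minSmoothness_of_isRCLikeNormedField]
      infer_instance
    exact ContMDiffAt.mlieBracket_vectorField (n := ⊤) (m := ⊤)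
      (V.contMDiff x) (W.contMDiff x) (by simp)

end DeRham

end QuantumBracket

end

noncomputable section

namespace QuantumBracket

open Filter VectorField
open scoped Topology

section Contraction

variable {E : Type*} [NormedAddCommGroup E] [NormedSpace ℝ E]
  {H : Type*} [TopologicalSpace H] {I : ModelWithCorners ℝ E H}
  {M : Type*} [TopologicalSpace M] [ChartedSpace H M] [IsManifold I ∞ M]

/-- The contraction `x ↦ α x (V x)` of a one-form with a vector field. -/
def contraction :
    SmoothVectorField I M →ₗ[C^∞⟮I, M; ℝ⟯] OneForm I M →ₗ[C^∞⟮I, M; ℝ⟯] C^∞⟮I, M; ℝ⟯ :=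
  LinearMap.mk₂ _
    (fun V α => ⟨fun x => α x (V x), fun x => (Bundle.contMDiffAt_section x).1
      ((α.contMDiff x).clm_bundle_apply (V.contMDiff x))⟩)
    (fun V W α => by ext x; exact map_add (α x) (V x) (W x))
    (fun c V α => by ext x; exact map_smul (α x) (c x) (V x))
    (fun _ _ _ => rfl)
    (fun _ _ _ => rfl)

theorem contraction_differential_apply (V : SmoothVectorField I M) (f : C^∞⟮I, M; ℝ⟯) (x : M) :
    contraction V (differential f) x = mvfderiv I f x (V x) := rfl

/-- The derivative of the chart representative of `h` along the chart representative of `v`. -/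
theorem fderivWithin_comp_extChartAt_symm_inverse (h : C^∞⟮I, M; ℝ⟯) (x : M) {y : E}
    (hy : y ∈ (extChartAt I x).target) (v : TangentSpace I ((extChartAt I x).symm y)) :
    fderivWithin ℝ (h ∘ (extChartAt I x).symm) (Set.range I) y
        ((mfderivWithin 𝓘(ℝ, E) I (extChartAt I x).symm (Set.range I) y).inverse v)
      = mvfderiv I h ((extChartAt I x).symm y) v := by
  have hr : y ∈ Set.range I := extChartAt_target_subset_range x hy
  have h1 : mfderivWithin 𝓘(ℝ, E) 𝓘(ℝ, ℝ) (h ∘ (extChartAt I x).symm) (Set.range I) y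
      = (mfderiv I 𝓘(ℝ, ℝ) h ((extChartAt I x).symm y)).comp
        (mfderivWithin 𝓘(ℝ, E) I (extChartAt I x).symm (Set.range I) y) :=
    mfderiv_comp_mfderivWithin y h.mdifferentiableAt
      (mdifferentiableWithinAt_extChartAt_symm hy) (I.uniqueMDiffOn y hr)
  have h2 := (isInvertible_mfderivWithin_extChartAt_symm (I := I) hy).self_apply_inverse v
  rw [← mfderivWithin_eq_fderivWithin, h1]
  exact congrArg (mfderiv I 𝓘(ℝ, ℝ) h ((extChartAt I x).symm y)) h2

theorem mvfderiv_mlieBracket [FiniteDimensional ℝ E] (V W : SmoothVectorField I M)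
    (f : C^∞⟮I, M; ℝ⟯) (x : M) :
    mvfderiv I f x (mlieBracket I V W x)
      = mvfderiv I (contraction W (differential f)) x (V x)
        - mvfderiv I (contraction V (differential f)) x (W x) := by
  have : CompleteSpace E := FiniteDimensional.complete ℝ E
  have : IsManifold I 2 M := IsManifold.of_le (n := ∞) (by norm_cast)
  have hx := mem_extChartAt_target (I := I) x
  have hmem : extChartAt I x x ∈ Set.range I := Set.mem_range_self _
  have hdiff (U : SmoothVectorField I M) :
      DifferentiableWithinAt ℝ (mpullbackWithin 𝓘(ℝ, E) I (extChartAt I x).symm U (Set.range I))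
        (Set.range I) (extChartAt I x x) := by
    have := (U.mdifferentiableAt (x := x)).mdifferentiableWithinAt (s := Set.univ)
      |>.differentiableWithinAt_mpullbackWithin_vectorField
    simpa using this
  have hF : ContDiffWithinAt ℝ ∞ (f ∘ (extChartAt I x).symm) (Set.range I) (extChartAt I x x) := by
    exact (f.contMDiff.contMDiffAt.comp_contMDiffWithinAt _
      (contMDiffWithinAt_extChartAt_symm_range x hx)).contDiffWithinAt
  have key := fderivWithin_apply_lieBracket hF
    (by rw [minSmoothness_of_isRCLikeNormedField]; norm_cast) I.uniqueDiffOn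
    (I.range_subset_closure_interior hmem) hmem (hdiff W) (hdiff V)
  have hder (U : SmoothVectorField I M) :
      fderivWithin ℝ (fun y => fderivWithin ℝ (f ∘ (extChartAt I x).symm) (Set.range I) y
          (mpullbackWithin 𝓘(ℝ, E) I (extChartAt I x).symm U (Set.range I) y))
        (Set.range I) (extChartAt I x x)
      = fderivWithin ℝ ((contraction U (differential f) : C^∞⟮I, M; ℝ⟯) ∘ (extChartAt I x).symm)
        (Set.range I) (extChartAt I x x) := by
    have hev : ∀ᶠ y in 𝓝[Set.range I] (extChartAt I x x),
        fderivWithin ℝ (f ∘ (extChartAt I x).symm) (Set.range I) y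
          (mpullbackWithin 𝓘(ℝ, E) I (extChartAt I x).symm U (Set.range I) y)
        = ((contraction U (differential f) : C^∞⟮I, M; ℝ⟯) ∘ (extChartAt I x).symm) y := by
      filter_upwards [extChartAt_target_mem_nhdsWithin x] with y hy
      exact fderivWithin_comp_extChartAt_symm_inverse f x hy _
    exact EventuallyEq.fderivWithin_eq hev (hev.self_of_nhdsWithin hmem)
  have hpt (h : C^∞⟮I, M; ℝ⟯) (v : TangentSpace I x) :
      fderivWithin ℝ (h ∘ (extChartAt I x).symm) (Set.range I) (extChartAt I x x) v
        = mvfderiv I h x v := by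
    have h1 := h.mdifferentiableAt (x := x)
    rw [mvfderiv, h1.mfderiv]
    rfl
  have hinv (v : E) : (ContinuousLinearMap.id ℝ E).inverse v = v := by
    rw [ContinuousLinearMap.inverse_id]; rfl
  have hval (U : SmoothVectorField I M) :
      mpullbackWithin 𝓘(ℝ, E) I (extChartAt I x).symm U (Set.range I) (extChartAt I x x) = U x := by
    rw [mpullbackWithin_apply, mfderivWithin_range_extChartAt_symm]
    refine (hinv _).trans ?_
    exact congrArg (fun y => (U y : E)) (extChartAt_to_inv x)
  have hb : mlieBracket I V W x = lieBracketWithin ℝ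
      (mpullbackWithin 𝓘(ℝ, E) I (extChartAt I x).symm V (Set.range I))
      (mpullbackWithin 𝓘(ℝ, E) I (extChartAt I x).symm W (Set.range I))
      (Set.range I) (extChartAt I x x) := by
    rw [mlieBracket, mlieBracketWithin_apply, mfderiv_extChartAt_self,
      Set.preimage_univ, Set.univ_inter]
    exact hinv _
  rw [hder W, hder V, hval V, hval W] at key
  rw [hb]
  exact (hpt f _).symm.trans (key.trans (congrArg₂ _ (hpt _ _) (hpt _ _)))

end Contraction

theorem map_antisymmetrizer_tmul {k V W : Type*} [CommRing k] [AddCommGroup V] [Module k V]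
    [AddCommGroup W] [Module k W] (f : V ⊗[k] V →ₗ[k] W) (X Y : V) :
    f (antisymmetrizer k V (X ⊗ₜ[k] Y)) = f (X ⊗ₜ[k] Y) - f (Y ⊗ₜ[k] X) := by
  rw [antisymmetrizer_tmul, map_sub]

namespace ExteriorCalculus

variable {k A Ω₁ Ω₂ : Type*} [CommRing k] [CommRing A] [Algebra k A]
  [AddCommGroup Ω₁] [Module k Ω₁] [Module A Ω₁] [IsScalarTower k A Ω₁]
  [AddCommGroup Ω₂] [Module A Ω₂] (C : ExteriorCalculus k A Ω₁ Ω₂)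

theorem interior_d (X : C.vectorFields) (a : A) :
    C.interior X (C.d a) = (X : A →ₗ[k] A) a := by
  have h1 : C.lift ⟨X, X.2.1⟩ (1, 0) = 0 := by
    have h := C.lift_jetProlongation ⟨X, X.2.1⟩ 1
    rw [X.2.2 1 C.d.map_one_eq_zero] at h
    simpa [jetProlongation] using h
  have h2 : C.lift ⟨X, X.2.1⟩ (a, 0) = 0 := by
    have : ((a, 0) : A × Ω₁) = a • ((1, 0) : A × Ω₁) := by simp
    rw [this, map_smul, h1, smul_zero]
  calc C.lift ⟨X, X.2.1⟩ (0, C.d a)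
      = C.lift ⟨X, X.2.1⟩ (a, 0) + C.lift ⟨X, X.2.1⟩ (0, C.d a) := by rw [h2, zero_add]
    _ = C.lift ⟨X, X.2.1⟩ (C.jetProlongation a) := by
        rw [← map_add]; simp [jetProlongation]
    _ = (X : A →ₗ[k] A) a := C.lift_jetProlongation _ a

/-- The vector field `a ↦ θ (d a)` defined by an `A`-linear functional on one-forms. -/
def ofDual (θ : Ω₁ →ₗ[A] A) : C.vectorFields where
  val := (θ.restrictScalars k) ∘ₗ (C.d : A →ₗ[k] Ω₁)
  property := by
    refine ⟨⟨θ ∘ₗ LinearMap.snd A A Ω₁, fun a => ?_⟩, fun a ha => ?_⟩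
    · simp [jetProlongation]
    · simp [ha]

/-- Vector fields are the functionals on one-forms. -/
def vectorFieldsEquivDual : C.vectorFields ≃ₗ[A] (Ω₁ →ₗ[A] A) where
  __ := C.interior
  invFun := C.ofDual
  left_inv X := by
    ext a
    exact C.interior_d X a
  right_inv θ := sub_eq_zero.1 <| C.eq_zero_of_comp_d _ fun a => by
    exact sub_eq_zero.2 (C.interior_d (C.ofDual θ) a)

theorem bracket_apply {p : (C.vectorFields ⊗[k] C.vectorFields) →ₗ[k] C.asym}
    (hp : C.IsAntisymmetrization p) (X Y : C.vectorFields) (a : A) :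
    C.bracket p X Y a = (X : A →ₗ[k] A) ((Y : A →ₗ[k] A) a)
      - (Y : A →ₗ[k] A) ((X : A →ₗ[k] A) a) := by
  rw [bracket, hp]
  exact DFunLike.congr_fun (map_antisymmetrizer_tmul C.comp Y X) a

end ExteriorCalculus

theorem section_sum_apply {E : Type*} [NormedAddCommGroup E] [NormedSpace ℝ E]
    {H : Type*} [TopologicalSpace H] {I : ModelWithCorners ℝ E H}
    {M : Type*} [TopologicalSpace M] [ChartedSpace H M]
    {F : Type*} [NormedAddCommGroup F] [NormedSpace ℝ F] {V : M → Type*}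
    [TopologicalSpace (Bundle.TotalSpace F V)] [∀ x, AddCommGroup (V x)] [∀ x, Module ℝ (V x)]
    [∀ x, TopologicalSpace (V x)] [FiberBundle F V] [VectorBundle ℝ F V]
    {ι : Type*} (t : Finset ι) (s : ι → Cₛ^∞⟮I; F, V⟯) (x : M) :
    (∑ i ∈ t, s i) x = ∑ i ∈ t, s i x := by
  have h := congrFun (map_sum (ContMDiffSection.coeAddHom I F ∞ V) s t) x
  rwa [Finset.sum_apply] at h

variable {E : Type*} [NormedAddCommGroup E] [NormedSpace ℝ E] [FiniteDimensional ℝ E]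
  {H : Type*} [TopologicalSpace H] {I : ModelWithCorners ℝ E H}
  {M : Type*} [TopologicalSpace M] [ChartedSpace H M] [IsManifold I ∞ M] [T2Space M]

/-- Near every point, the differentials of suitable global functions form a coframe dual to a frame
of global vector fields. -/
theorem exists_dual_frame (x : M) :
    ∃ (ι : Type) (_ : Fintype ι) (g : ι → C^∞⟮I, M; ℝ⟯) (s : ι → SmoothVectorField I M),
      ∀ᶠ y in 𝓝 x, ∀ v : TangentSpace I y, v = ∑ i, mvfderiv I (g i) y v • s i y := by
  let b := Module.finBasis ℝ E
  let e := trivializationAt E (TangentSpace I : M → Type _) x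
  obtain ⟨χ, -, -⟩ := (SmoothBumpFunction.nhds_basis_support (I := I)
    (Filter.univ_mem : Set.univ ∈ nhds x)).mem_iff.1 Filter.univ_mem
  have hsrc : e.baseSet = (chartAt H x).source := by simp [e]
  have hg : ∀ i, ContMDiffOn I 𝓘(ℝ, ℝ) ∞ (fun y => b.coord i (extChartAt I x y))
      (chartAt H x).source := fun i =>
    (LinearMap.toContinuousLinearMap (b.coord i)).contMDiff.comp_contMDiffOn
      contMDiffOn_extChartAt
  let g : Fin (Module.finrank ℝ E) → C^∞⟮I, M; ℝ⟯ := fun i => ⟨_, χ.contMDiff_smul (hg i)⟩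
  have hs : ∀ i, ContMDiff I (I.prod 𝓘(ℝ, E)) ∞ (fun y => Bundle.TotalSpace.mk' E
      (E := (TangentSpace I : M → Type _)) y (χ y • e.localFrame b i y)) := by
    intro i
    have h1 := e.contMDiffOn_localFrame_baseSet (I := I) ∞ b i
    rw [hsrc] at h1
    exact ContMDiffOn.smul_section_of_tsupport χ.contMDiff.contMDiffOn (chartAt H x).open_source
      χ.tsupport_subset_chartAt_source h1
  let s : Fin (Module.finrank ℝ E) → SmoothVectorField I M := fun i => ⟨_, hs i⟩
  refine ⟨Fin (Module.finrank ℝ E), inferInstance, g, s, ?_⟩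
  filter_upwards [χ.eventuallyEq_one.eventuallyEq_nhds,
    (chartAt H x).open_source.mem_nhds (mem_chart_source H x)] with y hy hys v
  have hye : y ∈ e.baseSet := hsrc ▸ hys
  have hd : ∀ i, mvfderiv I (g i) y
      = (LinearMap.toContinuousLinearMap (b.coord i)) ∘L e.continuousLinearMapAt ℝ y := by
    intro i
    have h1 : g i =ᶠ[nhds y]
        (LinearMap.toContinuousLinearMap (b.coord i)) ∘ (extChartAt I x) := by
      filter_upwards [hy] with z hz
      change χ z • b.coord i (extChartAt I x z) = _
      simp [hz]
    rw [TangentBundle.continuousLinearMapAt_trivializationAt hys]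
    ext v
    have h2 := (LinearMap.toContinuousLinearMap (b.coord i)).hasMFDerivAt.comp y
      (mdifferentiableAt_extChartAt (I := I) hys).hasMFDerivAt
    have h3 := (h2.congr_of_eventuallyEq h1).mfderiv
    simp only [mvfderiv]
    rw [h3]
    rfl
  conv_lhs => rw [← (e.basisAt b hye).sum_repr v]
  refine Finset.sum_congr rfl fun i _ => ?_
  have hr : (e.basisAt b hye).repr v i = mvfderiv I (g i) y v := by
    rw [hd i]
    simp [Bundle.Trivialization.basisAt, hye]
  have hsi : s i y = e.basisAt b hye i := by
    change χ y • e.localFrame b i y = _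
    rw [hy.self_of_nhds, e.localFrame_apply_of_mem_baseSet b hye]
    exact one_smul ℝ _
  rw [hr, hsi]

/-- Functionals on one-forms are local. -/
theorem apply_eq_zero_of_eventually_eq_zero
    (θ : OneForm I M →ₗ[C^∞⟮I, M; ℝ⟯] C^∞⟮I, M; ℝ⟯) {η : OneForm I M} {x : M}
    (h : ∀ᶠ y in 𝓝 x, η y = 0) : θ η x = 0 := by
  obtain ⟨χ, hχ, hs⟩ := exists_bump (I := I) x _ h
  have h0 : χ • η = 0 := by
    ext y : 1
    by_cases hy : y ∈ Function.support χ
    · have : η y = 0 := hs hy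
      rw [section_smul_apply, this, smul_zero]; rfl
    · rw [section_smul_apply, Function.notMem_support.1 hy, zero_smul]; rfl
  have h1 := congrArg θ h0
  rw [map_smul, map_zero] at h1
  have h3 : χ x * (θ η) x = 0 := DFunLike.congr_fun h1 x
  rwa [hχ, one_mul] at h3

theorem eq_zero_of_forall_mvfderiv_eq_zero {x : M} (v : TangentSpace I x)
    (h : ∀ f : C^∞⟮I, M; ℝ⟯, mvfderiv I f x v = 0) : v = 0 := by
  obtain ⟨ι, _, g, s, hgs⟩ := exists_dual_frame (I := I) x
  rw [hgs.self_of_nhds v]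
  exact Finset.sum_eq_zero fun i _ => by rw [h]; exact zero_smul ℝ _

theorem contraction_injective :
    Function.Injective (contraction (I := I) (M := M)) := by
  refine (injective_iff_map_eq_zero _).2 fun V hV => ?_
  ext x : 1
  refine eq_zero_of_forall_mvfderiv_eq_zero _ fun f => ?_
  rw [← contraction_differential_apply, hV]
  rfl

/-- Near every point, a functional on one-forms is the contraction with a vector field. -/
theorem exists_local_contraction (θ : OneForm I M →ₗ[C^∞⟮I, M; ℝ⟯] C^∞⟮I, M; ℝ⟯) (x : M) :
    ∃ W : SmoothVectorField I M, ∀ᶠ y in 𝓝 x, ∀ η, θ η y = η y (W y) := by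
  obtain ⟨ι, _, g, s, hgs⟩ := exists_dual_frame (I := I) x
  refine ⟨∑ i, θ (differential (g i)) • s i, ?_⟩
  filter_upwards [hgs.eventually_nhds] with y hy η
  have h0 : ∀ᶠ z in 𝓝 y, (η - ∑ i, contraction (s i) η • differential (g i)) z = 0 := by
    filter_upwards [hy] with z hz
    refine sub_eq_zero.2 ?_
    rw [section_sum_apply]
    ext v
    have happ : (∑ i, (contraction (s i) η • differential (g i) : OneForm I M) z) v
        = ∑ i, (contraction (s i) η • differential (g i) : OneForm I M) z v := sum_apply _ _ _
    refine Eq.trans ?_ happ.symm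
    refine (congrArg (η z) (hz v)).trans ?_
    rw [map_sum]
    refine Finset.sum_congr rfl fun i _ => ?_
    exact ((η z).map_smul _ _).trans (mul_comm _ _)
  have h1 := apply_eq_zero_of_eventually_eq_zero θ h0
  rw [map_sub, map_sum] at h1
  refine (sub_eq_zero.1 h1).trans ?_
  change _ = contraction (∑ i, θ (differential (g i)) • s i) η y
  rw [map_sum, LinearMap.sum_apply]
  refine DFunLike.congr_fun (Finset.sum_congr rfl fun i _ => ?_) y
  rw [map_smul, map_smul, LinearMap.smul_apply, smul_eq_mul, smul_eq_mul, mul_comm]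

theorem contraction_surjective :
    Function.Surjective (contraction (I := I) (M := M)) := by
  intro θ
  choose W hW using exists_local_contraction θ
  have hV (x : M) : ∀ᶠ y in 𝓝 x, W y y = W x y := by
    filter_upwards [hW x] with y hy
    refine sub_eq_zero.1 (eq_zero_of_forall_mvfderiv_eq_zero _ fun f => ?_)
    rw [map_sub]
    exact sub_eq_zero.2 (((hW y).self_of_nhds (differential f)).symm.trans (hy (differential f)))
  refine ⟨⟨fun y => W y y, fun x => ((W x).contMDiff x).congr_of_eventuallyEq ?_⟩, ?_⟩
  · filter_upwards [hV x] with y hy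
    rw [hy]
  · ext η x
    exact ((hW x).self_of_nhds η).symm

variable (I M) in
/-- Smooth vector fields are the functionals on smooth one-forms. -/
def contractionEquiv :
    SmoothVectorField I M ≃ₗ[C^∞⟮I, M; ℝ⟯] (OneForm I M →ₗ[C^∞⟮I, M; ℝ⟯] C^∞⟮I, M; ℝ⟯) :=
  LinearEquiv.ofBijective contraction ⟨contraction_injective, contraction_surjective⟩

theorem pairing_contraction_sub {X Y : (deRham I M).vectorFields} {V W : SmoothVectorField I M}
    (hV : contraction V = (deRham I M).interior X) (hW : contraction W = (deRham I M).interior Y)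
    (σ : OneForm I M ⊗[C^∞⟮I, M; ℝ⟯] OneForm I M) (x : M) :
    ((deRham I M).pairing (X ⊗ₜ Y) σ - (deRham I M).pairing (Y ⊗ₜ X) σ) x
      = TensorProduct.lift (deRham I M).wedge σ x ![W x, V x] := by
  induction σ with
  | zero => simp only [map_zero, sub_zero]; rfl
  | add σ τ hσ hτ =>
    simp only [map_add]
    rw [add_sub_add_comm]
    exact congrArg₂ (· + ·) hσ hτ
  | tmul α β =>
    rw [ExteriorCalculus.pairing_tmul, ExteriorCalculus.pairing_tmul, ← hV, ← hW,
      TensorProduct.lift.tmul]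
    refine Eq.trans ?_ (wedgeAt_apply (α x) (β x) ![W x, V x]).symm
    change β x (V x) * α x (W x) - β x (W x) * α x (V x)
      = α x (W x) * β x (V x) - α x (V x) * β x (W x)
    ring

theorem antisymmetrizer_mem_asym
    (t : (deRham I M).vectorFields ⊗[ℝ] (deRham I M).vectorFields) :
    antisymmetrizer ℝ (deRham I M).vectorFields t ∈ (deRham I M).asym := by
  intro σ hσ
  let P : (deRham I M).vectorFields ⊗[ℝ] (deRham I M).vectorFields →ₗ[ℝ] C^∞⟮I, M; ℝ⟯ :=
    (((deRham I M).pairing.flip σ).restrictScalars ℝ) ∘ₗ (deRham I M).tensorProj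
  have hP : P ∘ₗ antisymmetrizer ℝ (deRham I M).vectorFields = 0 := by
    refine TensorProduct.ext' fun X Y => ?_
    obtain ⟨V, hV⟩ := contraction_surjective ((deRham I M).interior X)
    obtain ⟨W, hW⟩ := contraction_surjective ((deRham I M).interior Y)
    refine (map_antisymmetrizer_tmul P X Y).trans ?_
    ext x
    refine (pairing_contraction_sub hV hW σ x).trans ?_
    rw [LinearMap.mem_ker.1 hσ]
    rfl
  exact DFunLike.congr_fun hP t

end QuantumBracket

end

theorem proposition6p17
    {E : Type*} [NormedAddCommGroup E] [NormedSpace ℝ E] [FiniteDimensional ℝ E]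
    {H : Type*} [TopologicalSpace H] (I : ModelWithCorners ℝ E H) [I.Boundaryless]
    (M : Type*) [TopologicalSpace M] [ChartedSpace H M] [IsManifold I ∞ M]
    [T2Space M] [SecondCountableTopology M] :
    ∃ p : ((QuantumBracket.deRham I M).vectorFields ⊗[ℝ]
          (QuantumBracket.deRham I M).vectorFields) →ₗ[ℝ] (QuantumBracket.deRham I M).asym,
      (QuantumBracket.deRham I M).IsAntisymmetrization p ∧
      (∀ X Y : (QuantumBracket.deRham I M).vectorFields,
        (QuantumBracket.deRham I M).bracket p X Y ∈ (QuantumBracket.deRham I M).vectorFields) ∧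
      ∃ Φ : QuantumBracket.SmoothVectorField I M ≃ₗ[C^∞⟮I, M; ℝ⟯]
          (QuantumBracket.deRham I M).vectorFields,
        (∀ (V : QuantumBracket.SmoothVectorField I M) (f : C^∞⟮I, M; ℝ⟯) (x : M),
          (Φ V : C^∞⟮I, M; ℝ⟯ →ₗ[ℝ] C^∞⟮I, M; ℝ⟯) f x = mvfderiv I f x (V x)) ∧
        ∀ V W : QuantumBracket.SmoothVectorField I M,
          (QuantumBracket.deRham I M).bracket p (Φ V) (Φ W)
            = (Φ (QuantumBracket.lieBracket V W) : C^∞⟮I, M; ℝ⟯ →ₗ[ℝ] C^∞⟮I, M; ℝ⟯) := by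
  let p := (QuantumBracket.antisymmetrizer ℝ (QuantumBracket.deRham I M).vectorFields).codRestrict
    (QuantumBracket.deRham I M).asym QuantumBracket.antisymmetrizer_mem_asym
  have hp : (QuantumBracket.deRham I M).IsAntisymmetrization p := fun _ => rfl
  let Φ := QuantumBracket.contractionEquiv I M ≪≫ₗ
    (QuantumBracket.deRham I M).vectorFieldsEquivDual.symm
  have hΦ (V W : QuantumBracket.SmoothVectorField I M) :
      (QuantumBracket.deRham I M).bracket p (Φ V) (Φ W)
      = (Φ (QuantumBracket.lieBracket V W) : C^∞⟮I, M; ℝ⟯ →ₗ[ℝ] C^∞⟮I, M; ℝ⟯) := by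
    ext f x
    rw [QuantumBracket.ExteriorCalculus.bracket_apply _ hp]
    exact (QuantumBracket.mvfderiv_mlieBracket V W f x).symm
  refine ⟨p, hp, fun X Y => ?_, Φ, fun _ _ _ => rfl, hΦ⟩
  rw [← Φ.apply_symm_apply X, ← Φ.apply_symm_apply Y, hΦ]
  exact SetLike.coe_mem _
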